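/- Let $G$ be an amenable (discrete) group, $A$ an abelian group, and $\alpha$ a left action of $G$ on $A$ by group automorphisms. Let $N$ be a non-trivial normal subgroup of $G$ such that $G/N$ is infinite, and let $\alpha\restriction_N$ be the restriction of $\alpha$ to $N$ (which is again amenable). (a) If $\mathrm{ent}(\alpha\restriction_N)<\infty$, then $\mathrm{ent}(\alpha)=0$. (b) If $h_{alg}(\alpha\restriction_N)<\infty$, then $h_{alg}(\alpha)=0$. Here, for an action $\beta$ of an amenable group $S$ on $A$ and a non-empty finite subset $X$ of $A$, put $T_F(\beta,X)=\sum_{s\in F}\beta(s)(X)\subseteq A$ (the sum of subsets) for each non-empty finite $F\subseteq S$, and $$H_{alg}(\beta,X)=\lim_{i\in I}\frac{\log|T_{F_i}(\beta,X)|}{|F_i|},$$ where $(F_i)_{i\in I}$ is a right Følner net of $S$, that is, a net of non-empty finite subsets of $S$ with $\lim_{i}|F_is\setminus F_i|/|F_i|=0$ for every $s\in S$; the limit exists and does not depend on the net. Then $h_{alg}(\beta)$ is the supremum of $H_{alg}(\beta,X)$ over all non-empty finite subsets $X$ of $A$, and $\mathrm{ent}(\beta)$ is the supremum of $H_{alg}(\beta,X)$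 over all finite subgroups $X$ of $A$; both take values in $[0,\infty]$. -/

import Mathlib

open Filter Topology
open scoped Pointwise

noncomputable section

namespace AlgebraicEntropy

/-! ### Amenability -/

/-- `S` is left amenable: there is a finitely additive probability measure `μ`, defined on all
subsets of `S`, with `μ (L_s⁻¹ F) = μ F` for every left multiplication `L_s`. -/
def IsLeftAmenable (S : Type*) [Semigroup S] : Prop :=
  ∃ μ : Set S → ℝ,
    (∀ F, μ F ∈ Set.Icc (0 : ℝ) 1) ∧
    μ Set.univ = 1 ∧
    (∀ F E : Set S, Disjoint F E → μ (F ∪ E) = μ F + μ E) ∧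
    ∀ (s : S) (F : Set S), μ ((fun x => s * x) ⁻¹' F) = μ F

/-- `S` is right amenable: the same with right multiplications, i.e. the opposite semigroup of `S`
is left amenable. -/
def IsRightAmenable (S : Type*) [Semigroup S] : Prop :=
  ∃ μ : Set S → ℝ,
    (∀ F, μ F ∈ Set.Icc (0 : ℝ) 1) ∧
    μ Set.univ = 1 ∧
    (∀ F E : Set S, Disjoint F E → μ (F ∪ E) = μ F + μ E) ∧
    ∀ (s : S) (F : Set S), μ ((fun x => x * s) ⁻¹' F) = μ F

/-- `S` is amenable: it is left amenable and right amenable. -/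
def IsAmenable (S : Type*) [Semigroup S] : Prop :=
  IsLeftAmenable S ∧ IsRightAmenable S

/-! ### Right Følner nets -/

/-- The ratio `|F s \ F| / |F|`. -/
def rightDefect {S : Type*} [Semigroup S] (s : S) (F : Finset S) : ℝ :=
  (((fun x => x * s) '' (F : Set S) \ (F : Set S)).ncard : ℝ) / (F.card : ℝ)

/-- A right Følner net of `S`: a family `F` of non-empty finite subsets of `S`, indexed by a type
with a filter `l` (the filter `atTop`, for a directed index set), such that `|F i s \ F i| / |F i|`
tends to `0` for every `s`. -/
def IsRightFolnerNet {S : Type*} [Semigroup S] {ι : Type*} (l : Filter ι)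
    (F : ι → Finset S) : Prop :=
  (∀ᶠ i in l, (F i).Nonempty) ∧ ∀ s : S, Tendsto (fun i => rightDefect s (F i)) l (𝓝 0)

/-- The right Følner filter of `S`: the coarsest filter on the finite subsets of `S` along which
the subsets are non-empty and `|F s \ F| / |F|` tends to `0` for every `s`. -/
def rightFolner (S : Type*) [Semigroup S] : Filter (Finset S) :=
  𝓟 {F | F.Nonempty} ⊓ ⨅ s : S, comap (rightDefect s) (𝓝 0)

/-- A family is a right Følner net if and only if it converges to the right Følner filter. So a limit
along this filter is a limit along every right Følner net. -/
theorem isRightFolnerNet_iff {S : Type*} [Semigroup S] {ι : Type*} (l : Filter ι)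
    (F : ι → Finset S) : IsRightFolnerNet l F ↔ Tendsto F l (rightFolner S) := by
  simp only [IsRightFolnerNet, rightFolner, tendsto_inf, tendsto_principal, tendsto_iInf,
    tendsto_comap_iff, Set.mem_ofPred_eq]
  rfl

/-! ### Algebraic entropy -/

variable {S A : Type*} [Monoid S] [AddCommGroup A]

/-- The trajectory `T_F(α, X) = ∑ s ∈ F, α(s)(X)` (a Minkowski sum of subsets of `A`). -/
def trajectory (α : S →* AddMonoid.End A) (F : Finset S) (X : Set A) : Set A :=
  ∑ s ∈ F, (fun x => α s x) '' X

/-- The algebraic entropy `H_alg(α, X)` of `α` with respect to the finite non-empty set `X`: the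
limit of `log |T_F(α, X)| / |F|` along the right Følner nets of `S`, that is, along the right Følner
filter. For cancellative right amenable `S` that filter is proper and the limit exists. -/
def algEntropyOn (α : S →* AddMonoid.End A) (X : Set A) : ℝ :=
  limUnder (rightFolner S) fun F : Finset S =>
    Real.log ((trajectory α F X).ncard : ℝ) / (F.card : ℝ)

/-- The algebraic entropy `h_alg(α)`: the supremum of `H_alg(α, X)` over the non-empty finite
subsets `X` of `A`. -/
def hAlg (α : S →* AddMonoid.End A) : EReal :=
  ⨆ (X : Set A) (_ : X.Nonempty ∧ X.Finite), (algEntropyOn α X : EReal)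

/-- The algebraic entropy `ent(α)`: the supremum of `H_alg(α, B)` over the finite subgroups `B`
of `A`. -/
def ent (α : S →* AddMonoid.End A) : EReal :=
  ⨆ (B : AddSubgroup A) (_ : (B : Set A).Finite), (algEntropyOn α (B : Set A) : EReal)

end AlgebraicEntropy

end

namespace AlgebraicEntropy

/-! ### Shearer's inequality for projections and for sumsets -/

/-! The limit defining `algEntropyOn α X` is an infimum over all non-empty finite `E`, Følner or
not, of `log |T_E(α, X)| / |E|` (`algEntropyOn_eq_sInf`). So a single well-chosen `E` bounds it.
Take `E = M R` with `M` a finite subset of `N` and `R` a set of `n + 1` representatives of cosets of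
`N`. Then `T_E(α, X) = T_M(α|_N, T_R(α, X))` and `|E| = |M| (n + 1)`. Choosing `M` well for `T_R(α,
X)` bounds the entropy by `(C + 1) / (n + 1)`, where `C` bounds the entropy of the restriction.
Since `G/N` is infinite, `n` is arbitrary. For `ent`, `T_R` of a finite subgroup is again a finite
subgroup.

The infimum rule comes from a Shearer inequality for sumsets (`card_sum_pow_le_prod`), applied to
the pieces `F ∩ g E`, which cover each point of `F` exactly `|E|` times. Følner's theorem, for `G`
and for `N`, makes the Følner filter proper, so that `limUnder` is the actual limit. -/

open Finset in
theorem prod_le_arith_mean_pow {ι : Type*} (J : Finset ι) (hJ : J.Nonempty) (z : ι → ℝ)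
    (hz : ∀ j ∈ J, 0 ≤ z j) : ∏ j ∈ J, z j ≤ ((∑ j ∈ J, z j) / #J) ^ #J := by
  have hJ0 : (#J : ℝ) ≠ 0 := by exact_mod_cast hJ.card_pos.ne'
  have h := Real.geom_mean_le_arith_mean_weighted J (fun _ => (#J : ℝ)⁻¹) z
    (fun _ _ => by positivity) (by simp [hJ0]) hz
  rw [← Finset.mul_sum, inv_mul_eq_div] at h
  have h2 := pow_le_pow_left₀ (Finset.prod_nonneg fun j hj => Real.rpow_nonneg (hz j hj) _) h #J
  rw [← Finset.prod_pow] at h2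
  refine le_trans (le_of_eq ?_) h2
  exact Finset.prod_congr rfl fun j hj =>
    (Real.rpow_inv_natCast_pow (hz j hj) hJ.card_pos.ne').symm

/-- Hölder's inequality for a product of `#J` sums. -/
theorem sum_pow_card_le_prod_sum {ι κ : Type*} (J : Finset ι) (hJ : J.Nonempty) (Y : Finset κ)
    (u : κ → ℝ) (P : ℝ) (a : ι → κ → ℝ) (hu : ∀ y ∈ Y, 0 ≤ u y) (hP : 0 ≤ P)
    (ha : ∀ j ∈ J, ∀ y ∈ Y, 0 ≤ a j y)
    (h : ∀ y ∈ Y, u y ^ J.card ≤ P * ∏ j ∈ J, a j y) :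
    (∑ y ∈ Y, u y) ^ J.card ≤ P * ∏ j ∈ J, ∑ y ∈ Y, a j y := by
  have hk : J.card ≠ 0 := hJ.card_pos.ne'
  have hA : ∀ j ∈ J, 0 ≤ ∑ y ∈ Y, a j y := fun j hj => Finset.sum_nonneg (ha j hj)
  by_cases h0 : ∃ j ∈ J, ∑ y ∈ Y, a j y = 0
  · obtain ⟨j, hj, hj0⟩ := h0
    rw [Finset.sum_eq_zero_iff_of_nonneg (ha j hj)] at hj0
    have : ∑ y ∈ Y, u y = 0 := Finset.sum_eq_zero fun y hy => by
      have := h y hy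
      rw [Finset.prod_eq_zero hj (hj0 y hy), mul_zero] at this
      exact eq_zero_of_pow_eq_zero (le_antisymm this (pow_nonneg (hu y hy) _))
    rw [this, zero_pow hk]
    exact mul_nonneg hP (Finset.prod_nonneg hA)
  push Not at h0
  set A : ι → ℝ := fun j => ∑ y ∈ Y, a j y with hAdef
  set D : ℝ := (P * ∏ j ∈ J, A j) ^ ((J.card : ℝ)⁻¹) with hD
  have hPA : 0 ≤ P * ∏ j ∈ J, A j := mul_nonneg hP (Finset.prod_nonneg hA)
  have hD0 : 0 ≤ D := Real.rpow_nonneg hPA _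
  have hDk : D ^ J.card = P * ∏ j ∈ J, A j := Real.rpow_inv_natCast_pow hPA hk
  -- AM-GM at each `y`, after scaling every sum `A j` to `1`; summing over `y` then gives `D`.
  have key : ∀ y ∈ Y, u y ≤ D * ((∑ j ∈ J, a j y / A j) / J.card) := by
    intro y hy
    have hz : ∀ j ∈ J, 0 ≤ a j y / A j := fun j hj => div_nonneg (ha j hj y hy) (hA j hj)
    have hb : 0 ≤ D * ((∑ j ∈ J, a j y / A j) / J.card) :=
      mul_nonneg hD0 (div_nonneg (Finset.sum_nonneg hz) (Nat.cast_nonneg _))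
    refine (pow_le_pow_iff_left₀ (hu y hy) hb hk).1 ((h y hy).trans ?_)
    rw [mul_pow, hDk]
    have e : ∏ j ∈ J, a j y = (∏ j ∈ J, A j) * ∏ j ∈ J, a j y / A j := by
      rw [← Finset.prod_mul_distrib]
      exact Finset.prod_congr rfl fun j hj => (mul_div_cancel₀ _ (h0 j hj)).symm
    rw [e, ← mul_assoc]
    exact mul_le_mul_of_nonneg_left (prod_le_arith_mean_pow J hJ _ hz) hPA
  rw [← hDk]
  refine pow_le_pow_left₀ (Finset.sum_nonneg hu) ((Finset.sum_le_sum key).trans (le_of_eq ?_)) _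
  rw [← Finset.mul_sum, ← Finset.sum_div, Finset.sum_comm]
  have : ∑ j ∈ J, ∑ y ∈ Y, a j y / A j = J.card := by
    rw [Finset.sum_congr rfl fun j hj => by rw [← Finset.sum_div, div_self (h0 j hj)]]
    simp
  rw [this, div_self (by exact_mod_cast hk), mul_one]

/-- The number of restrictions to `E` of the functions in `W`. -/
noncomputable def projCard {ι Y : Type*} (W : Finset (ι → Y)) (E : Finset ι) : ℕ :=
  by classical exact (W.image fun w => fun i : E => w i).card

section Projections

variable {ι Y : Type*}

theorem projCard_mono {W W' : Finset (ι → Y)} (h : W ⊆ W') (E : Finset ι) :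
    projCard W E ≤ projCard W' E := by
  classical
  exact Finset.card_le_card (Finset.image_subset_image h)

theorem projCard_le {W : Finset (ι → Y)} {β : Type*} {E : Finset ι} {T : Finset β}
    (φ : (ι → Y) → β) (hT : ∀ w ∈ W, φ w ∈ T)
    (hφ : ∀ w ∈ W, ∀ w' ∈ W, φ w = φ w' → ∀ i ∈ E, w i = w' i) :
    projCard W E ≤ T.card := by
  classical
  rw [projCard]
  refine Finset.card_le_card_of_forall_subsingleton
    (fun p t => ∃ w ∈ W, (fun i : E => w i) = p ∧ φ w = t) ?_ ?_
  · intro p hp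
    obtain ⟨w, hw, rfl⟩ := Finset.mem_image.1 hp
    exact ⟨φ w, hT w hw, w, hw, rfl, rfl⟩
  · rintro t - p ⟨-, w, hw, rfl, h⟩ q ⟨-, w', hw', rfl, h'⟩
    funext i
    exact hφ w hw w' hw' (h.trans h'.symm) i i.2

theorem le_projCard {W : Finset (ι → Y)} {β : Type*} {E : Finset ι} {T : Finset β}
    (φ : (E → Y) → β) (hT : ∀ t ∈ T, ∃ w ∈ W, φ (fun i => w i) = t) :
    T.card ≤ projCard W E := by
  classical
  refine Finset.card_le_card_of_forall_subsingleton (fun t p => φ p = t) (fun t ht => ?_) ?_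
  · obtain ⟨w, hw, h⟩ := hT t ht
    exact ⟨_, Finset.mem_image_of_mem _ hw, h⟩
  · rintro p - a ⟨-, rfl⟩ b ⟨-, rfl⟩
    rfl

open scoped Classical in
/-- Splitting a projection according to the value of one of its coordinates. -/
theorem projCard_eq_sum (W : Finset (ι → Y)) {E : Finset ι} {i : ι} (hi : i ∈ E) :
    projCard W E = ∑ y ∈ W.image (fun w => w i), projCard (W.filter fun w => w i = y) E := by
  unfold projCard
  rw [Finset.card_eq_sum_card_fiberwise (f := fun p : E → Y => p ⟨i, hi⟩)
    (t := W.image (fun w => w i))]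
  · refine Finset.sum_congr rfl fun y _ => congrArg Finset.card ?_
    ext p
    simp only [Finset.mem_filter, Finset.mem_image]
    constructor
    · rintro ⟨⟨w, hw, rfl⟩, h⟩
      exact ⟨w, ⟨hw, h⟩, rfl⟩
    · rintro ⟨w, ⟨hw, h⟩, rfl⟩
      exact ⟨⟨w, hw, rfl⟩, h⟩
  · intro p hp
    obtain ⟨w, hw, rfl⟩ := Finset.mem_image.1 hp
    exact Finset.mem_image.2 ⟨w, hw, rfl⟩

theorem projCard_insert_le [DecidableEq ι] (W : Finset (ι → Y)) (F : Finset ι) {i : ι} {y : Y}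
    (h : ∀ w ∈ W, w i = y) : projCard W (insert i F) ≤ projCard W F := by
  classical
  rw [projCard.eq_1 W F]
  refine projCard_le (fun w => fun i : F => w i) (fun w hw => Finset.mem_image_of_mem _ hw) ?_
  intro w hw w' hw' e j hj
  rcases Finset.mem_insert.1 hj with rfl | hj
  · rw [h w hw, h w' hw']
  · exact congrFun e ⟨j, hj⟩

/-- Shearer's inequality. -/
theorem projCard_pow_le_prod {κ : Type*} [DecidableEq ι] (J : Finset κ) (E : κ → Finset ι)
    (k : ℕ) (hk : k ≠ 0) (F : Finset ι)
    (hE : ∀ i ∈ F, (J.filter fun j => i ∈ E j).card = k) (W : Finset (ι → Y)) (hW : W.Nonempty) :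
    projCard W F ^ k ≤ ∏ j ∈ J, projCard W (E j) := by
  classical
  have pos : ∀ (W : Finset (ι → Y)), W.Nonempty → ∀ E, 1 ≤ projCard W E := fun W hW E =>
    Finset.card_pos.2 (hW.image _)
  induction F using Finset.induction_on generalizing W with
  | empty =>
    have h1 : projCard W (∅ : Finset ι) ≤ 1 :=
      (projCard_le (T := {()}) (fun _ => ()) (by simp) (by simp)).trans (by simp)
    calc _ ≤ 1 ^ k := Nat.pow_le_pow_left h1 k
      _ = 1 := one_pow k
      _ ≤ _ := Finset.one_le_prod' fun j _ => pos W hW (E j)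
  | insert i F hi ih =>
    set J1 := J.filter fun j => i ∈ E j with hJ1
    have hcard : J1.card = k := hE i (Finset.mem_insert_self i F)
    have hJ1ne : J1.Nonempty := Finset.card_pos.1 (by omega)
    set V : Y → Finset (ι → Y) := fun y => W.filter fun w => w i = y with hV
    have hVne : ∀ y ∈ W.image (fun w => w i), (V y).Nonempty := by
      intro y hy
      obtain ⟨w, hw, rfl⟩ := Finset.mem_image.1 hy
      exact ⟨w, Finset.mem_filter.2 ⟨hw, rfl⟩⟩
    -- On a fibre `V y` the coordinate `i` is constant and costs nothing. Factors with `i ∉ E j` are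
    -- bounded by those of `W`; the `k` others stay and are summed over `y` by Hölder.
    have step : ∀ y ∈ W.image (fun w => w i), projCard (V y) (insert i F) ^ k ≤
        (∏ j ∈ J.filter (fun j => i ∉ E j), projCard W (E j)) *
          ∏ j ∈ J1, projCard (V y) (E j) := by
      intro y hy
      calc projCard (V y) (insert i F) ^ k ≤ projCard (V y) F ^ k :=
            Nat.pow_le_pow_left (projCard_insert_le _ F
              fun w hw => (Finset.mem_filter.1 hw).2) k
        _ ≤ ∏ j ∈ J, projCard (V y) (E j) :=
            ih (fun i hi => hE i (Finset.mem_insert_of_mem hi)) _ (hVne y hy)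
        _ = (∏ j ∈ J.filter (fun j => i ∉ E j), projCard (V y) (E j)) *
              ∏ j ∈ J1, projCard (V y) (E j) := by
            rw [mul_comm, hJ1, Finset.prod_filter_mul_prod_filter_not]
        _ ≤ _ := Nat.mul_le_mul_right _
            (Finset.prod_le_prod' fun j _ => projCard_mono (Finset.filter_subset _ _) _)
    have := sum_pow_card_le_prod_sum J1 hJ1ne (W.image fun w => w i)
      (fun y => (projCard (V y) (insert i F) : ℝ))
      (∏ j ∈ J.filter (fun j => i ∉ E j), projCard W (E j) : ℕ)
      (fun j y => (projCard (V y) (E j) : ℝ)) (fun _ _ => Nat.cast_nonneg _) (Nat.cast_nonneg _)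
      (fun _ _ _ _ => Nat.cast_nonneg _) (by rw [hcard]; exact_mod_cast step)
    rw [hcard] at this
    norm_cast at this
    rw [← projCard_eq_sum W (Finset.mem_insert_self i F)] at this
    refine this.trans (le_of_eq ?_)
    rw [Finset.prod_congr rfl fun j hj => (projCard_eq_sum W (Finset.mem_filter.1 hj).2).symm,
      mul_comm, Finset.prod_filter_mul_prod_filter_not]

end Projections

/-- A nonempty finite family of representations of the elements of a sumset, exactly one for each,
in which representations with equal partial sums over `E` agree on `E`. -/
theorem exists_representations {ι A : Type*} [AddCommGroup A] [DecidableEq A] [DecidableEq ι]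
    (Y : ι → Finset A) (F : Finset ι) :
    ∃ W : Finset (ι → A), (∀ w ∈ W, ∀ i ∈ F, w i ∈ Y i) ∧
      (∀ a ∈ ∑ i ∈ F, Y i, ∃ w ∈ W, ∑ i ∈ F, w i = a) ∧
      ∀ E ⊆ F, ∀ w ∈ W, ∀ w' ∈ W, ∑ i ∈ E, w i = ∑ i ∈ E, w' i → ∀ i ∈ E, w i = w' i := by
  classical
  obtain ⟨e, he⟩ := Set.countable_iff_exists_injOn.1 (F.sigma fun i => Y i).countable_toSet
  have he' : ∀ i ∈ F, ∀ x ∈ Y i, ∀ j ∈ F, ∀ y ∈ Y j, e ⟨i, x⟩ = e ⟨j, y⟩ → i = j ∧ x = y := by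
    intro i hi x hx j hj y hy h
    have := he (Finset.mem_coe.2 (Finset.mem_sigma.2 ⟨hi, hx⟩))
      (Finset.mem_coe.2 (Finset.mem_sigma.2 ⟨hj, hy⟩)) h
    simpa using this
  -- An additive weight that determines `w` on `E`, by uniqueness of binary expansions. The family
  -- consists of the representations of least weight.
  let c : Finset ι → (ι → A) → ℕ := fun E w => ∑ i ∈ E, 2 ^ e ⟨i, w i⟩
  have cinj : ∀ E ⊆ F, ∀ w w' : ι → A, (∀ i ∈ F, w i ∈ Y i) → (∀ i ∈ F, w' i ∈ Y i) →
      c E w = c E w' → ∀ i ∈ E, w i = w' i := by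
    intro E hEF w w' hw hw' h i hi
    have aux : ∀ v : ι → A, (∀ i ∈ F, v i ∈ Y i) →
        c E v = ∑ n ∈ E.image (fun i => e ⟨i, v i⟩), 2 ^ n := fun v hv => by
      rw [Finset.sum_image]
      intro i hi j hj hij
      exact (he' i (hEF hi) _ (hv i (hEF hi)) j (hEF hj) _ (hv j (hEF hj)) hij).1
    rw [aux w hw, aux w' hw'] at h
    have himg := Finset.geomSum_injective le_rfl h
    have : e ⟨i, w i⟩ ∈ E.image (fun i => e ⟨i, w' i⟩) :=
      himg ▸ Finset.mem_image_of_mem (fun i => e ⟨i, w i⟩) hi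
    obtain ⟨j, hj, hji⟩ := Finset.mem_image.1 this
    obtain ⟨rfl, h2⟩ := he' j (hEF hj) _ (hw' j (hEF hj)) i (hEF hi) _ (hw i (hEF hi)) hji
    exact h2.symm
  have hmin : ∀ a ∈ ∑ i ∈ F, Y i, ∃ w : ι → A, (∀ i ∈ F, w i ∈ Y i) ∧ ∑ i ∈ F, w i = a ∧
      ∀ w' : ι → A, (∀ i ∈ F, w' i ∈ Y i) → ∑ i ∈ F, w' i = a → c F w ≤ c F w' := by
    intro a ha
    have hex : ∃ n, ∃ w : ι → A, (∀ i ∈ F, w i ∈ Y i) ∧ ∑ i ∈ F, w i = a ∧ c F w = n := by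
      rw [← Finset.mem_coe, Finset.coe_sum, Set.mem_finsetSum] at ha
      obtain ⟨w, hw, rfl⟩ := ha
      exact ⟨_, w, fun i hi => hw hi, rfl, rfl⟩
    obtain ⟨w, hw, hs, hc⟩ := Nat.find_spec hex
    exact ⟨w, hw, hs, fun w' hw' hs' => hc ▸ Nat.find_min' hex ⟨w', hw', hs', rfl⟩⟩
  choose! r hr using hmin
  refine ⟨(∑ i ∈ F, Y i).image r, ?_, ?_, ?_⟩
  · intro w hw
    obtain ⟨a, ha, rfl⟩ := Finset.mem_image.1 hw
    exact (hr a ha).1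
  · exact fun a ha => ⟨r a, Finset.mem_image_of_mem r ha, (hr a ha).2.1⟩
  -- Exchange argument: replacing `r a` by `r b` on `E` keeps the total `a`, so minimality of `r a`
  -- compares the weights on `E`.
  · have half : ∀ E ⊆ F, ∀ a ∈ ∑ i ∈ F, Y i, ∀ b ∈ ∑ i ∈ F, Y i,
        ∑ i ∈ E, r a i = ∑ i ∈ E, r b i → c E (r a) ≤ c E (r b) := by
      intro E hEF a ha b hb h
      let v : ι → A := fun i => if i ∈ E then r b i else r a i
      have hvE : ∀ i ∈ E, v i = r b i := fun i hi => if_pos hi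
      have hvF : ∀ i ∈ F \ E, v i = r a i := fun i hi => if_neg (Finset.mem_sdiff.1 hi).2
      have hle := (hr a ha).2.2 v
        (fun i hi => by
          by_cases hiE : i ∈ E
          · rw [hvE i hiE]; exact (hr b hb).1 i hi
          · rw [hvF i (Finset.mem_sdiff.2 ⟨hi, hiE⟩)]; exact (hr a ha).1 i hi)
        (by
          rw [← Finset.sum_sdiff hEF, Finset.sum_congr rfl hvF, Finset.sum_congr rfl hvE, ← h,
            Finset.sum_sdiff hEF]
          exact (hr a ha).2.1)
      simp only [c] at hle ⊢
      rw [← Finset.sum_sdiff hEF, ← Finset.sum_sdiff hEF (f := fun i => 2 ^ e ⟨i, v i⟩),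
        Finset.sum_congr rfl fun i hi => show 2 ^ e ⟨i, v i⟩ = 2 ^ e ⟨i, r a i⟩ by rw [hvF i hi],
        Finset.sum_congr rfl fun i hi => show 2 ^ e ⟨i, v i⟩ = 2 ^ e ⟨i, r b i⟩ by
          rw [hvE i hi]] at hle
      exact Nat.add_le_add_iff_left.1 hle
    intro E hEF w hw w' hw' h
    obtain ⟨a, ha, rfl⟩ := Finset.mem_image.1 hw
    obtain ⟨b, hb, rfl⟩ := Finset.mem_image.1 hw'
    exact cinj E hEF _ _ (hr a ha).1 (hr b hb).1
      (le_antisymm (half E hEF a ha b hb h) (half E hEF b hb a ha h.symm))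

/-- Shearer's inequality for cardinalities of sumsets. -/
theorem card_sum_pow_le_prod {ι κ A : Type*} [AddCommGroup A] [DecidableEq A] [DecidableEq ι]
    (Y : ι → Finset A) (hY : ∀ i, (Y i).Nonempty) (F : Finset ι) (J : Finset κ)
    (E : κ → Finset ι) (hEF : ∀ j ∈ J, E j ⊆ F) (k : ℕ) (hk : k ≠ 0)
    (hE : ∀ i ∈ F, (J.filter fun j => i ∈ E j).card = k) :
    (∑ i ∈ F, Y i).card ^ k ≤ ∏ j ∈ J, (∑ i ∈ E j, Y i).card := by
  classical
  obtain ⟨W, hWY, hWsum, hWinj⟩ := exists_representations Y F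
  choose y hy using hY
  obtain ⟨w₀, hw₀, -⟩ := hWsum (∑ i ∈ F, y i) (by
    rw [← Finset.mem_coe, Finset.coe_sum, Set.mem_finsetSum]
    exact ⟨y, fun {i} _ => hy i, rfl⟩)
  calc (∑ i ∈ F, Y i).card ^ k ≤ projCard W F ^ k := by
        refine Nat.pow_le_pow_left (le_projCard (fun p => ∑ i, p i) fun a ha => ?_) k
        obtain ⟨w, hw, rfl⟩ := hWsum a ha
        exact ⟨w, hw, Finset.sum_coe_sort F w⟩
    _ ≤ ∏ j ∈ J, projCard W (E j) := projCard_pow_le_prod J E k hk F hE W ⟨w₀, hw₀⟩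
    _ ≤ _ := Finset.prod_le_prod' fun j hj =>
        projCard_le (fun w => ∑ i ∈ E j, w i)
          (fun w hw => by
            rw [← Finset.mem_coe, Finset.coe_sum, Set.mem_finsetSum]
            exact ⟨w, fun {i} hi => hWY w hw i (hEF j hj hi), rfl⟩)
          (hWinj (E j) (hEF j hj))

/-! ### Følner sets in amenable groups -/

/-- Coset representatives give a map `q : G → N` with `q (g n) = q g * n`; the mean of `G` is pushed
forward along it. -/
theorem IsRightAmenable.subgroup {G : Type*} [Group G] (h : IsRightAmenable G) (N : Subgroup G) :
    IsRightAmenable N := by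
  obtain ⟨μ, h01, huniv, hadd, hinv⟩ := h
  have hq : ∀ g : G, (Quotient.out (g : G ⧸ N))⁻¹ * g ∈ N := fun g =>
    QuotientGroup.eq.1 (QuotientGroup.out_eq' (g : G ⧸ N))
  let q : G → N := fun g => ⟨_, hq g⟩
  have hqmul : ∀ (g : G) (n : N), q (g * n) = q g * n := by
    intro g n
    have : ((g * n : G) : G ⧸ N) = g := QuotientGroup.eq.2 (by simp)
    ext
    simp only [q, this, Subgroup.coe_mul, mul_assoc]
  refine ⟨fun F => μ (q ⁻¹' F), fun F => h01 _, huniv, fun F E hd => ?_, fun s F => ?_⟩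
  · exact hadd _ _ (hd.preimage q)
  · have : q ⁻¹' ((fun x => x * s) ⁻¹' F) = (fun x : G => x * (s : G)) ⁻¹' (q ⁻¹' F) := by
      ext g
      simp only [Set.mem_preimage, hqmul]
    show μ (q ⁻¹' _) = μ (q ⁻¹' F)
    rw [this, hinv]

/-- A right invariant mean is preserved by injective maps which multiply each point on the right by
an element of a fixed finite set. -/
theorem mean_image_eq {G : Type*} [Group G] (μ : Set G → ℝ)
    (hadd : ∀ F E : Set G, Disjoint F E → μ (F ∪ E) = μ F + μ E)
    (hinv : ∀ (s : G) (F : Set G), μ ((fun x => x * s) ⁻¹' F) = μ F)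
    (φ : G → G) (hφ : Function.Injective φ) (K : Finset G) (D : Set G)
    (hD : ∀ g ∈ D, g⁻¹ * φ g ∈ K) : μ (φ '' D) = μ D := by
  classical
  induction K using Finset.induction_on generalizing D with
  | empty =>
    have : D = ∅ := Set.eq_empty_of_forall_notMem fun g hg => by simpa using hD g hg
    simp [this]
  | insert k K _ ih =>
    -- On this piece `φ` is right translation by `k`.
    set D1 := {g ∈ D | g⁻¹ * φ g = k} with hD1
    have hsub : D1 ⊆ D := fun g hg => hg.1
    have h1 : μ (φ '' D1) = μ D1 := by
      rw [← hinv k (φ '' D1)]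
      congr 1
      ext g
      constructor
      · rintro ⟨g', hg', h⟩
        have : φ g' = g' * k := by rw [← hg'.2]; group
        have e : g' = g := mul_right_cancel (this.symm.trans h)
        exact e ▸ hg'
      · intro hg
        exact ⟨g, hg, by simp only [← hg.2]; group⟩
    have h2 : μ (φ '' (D \ D1)) = μ (D \ D1) := ih _ fun g hg =>
      (Finset.mem_insert.1 (hD g hg.1)).resolve_left fun e => hg.2 ⟨hg.1, e⟩
    have hdis : Disjoint D1 (D \ D1) := Set.disjoint_sdiff_right
    rw [← Set.union_sdiff_cancel hsub, Set.image_union, hadd _ _ hdis,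
      hadd _ _ ((Set.disjoint_image_iff hφ).2 hdis), h1, h2]

/-- In a right amenable group, no finite set of right translations doubles the cardinality of all
finite sets. -/
theorem IsRightAmenable.exists_card_mul_lt {G : Type*} [Group G] [DecidableEq G]
    (h : IsRightAmenable G) (K : Finset G) :
    ∃ F : Finset G, (F * K).card < 2 * F.card := by
  classical
  by_contra! hK
  obtain ⟨μ, h01, huniv, hadd, hinv⟩ := h
  -- Doubling is Hall's condition for two copies of `G`. The matching embeds both copies disjointly,
  -- each with an image of mean `1`, which is impossible.
  obtain ⟨φ, hφ, hφK⟩ := (Finset.all_card_le_biUnion_card_iff_exists_injective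
    (fun p : G × Bool => p.1 • K)).1 (fun Z => by
      have hZ : Z.card ≤ 2 * (Z.image Prod.fst).card := by
        have : Z ⊆ Z.image Prod.fst ×ˢ Finset.univ := fun p hp =>
          Finset.mem_product.2 ⟨Finset.mem_image_of_mem _ hp, Finset.mem_univ _⟩
        refine (Finset.card_le_card this).trans ?_
        rw [Finset.card_product, Finset.card_univ, Fintype.card_bool, mul_comm]
      refine hZ.trans ((hK _).trans (Finset.card_le_card ?_))
      intro x hx
      obtain ⟨g, hg, k, hk, rfl⟩ := Finset.mem_mul.1 hx
      obtain ⟨p, hp, rfl⟩ := Finset.mem_image.1 hg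
      exact Finset.mem_biUnion.2 ⟨p, hp, Finset.smul_mem_smul_finset hk⟩)
  have hb : ∀ b, μ (Set.range fun g => φ (g, b)) = 1 := fun b => by
    rw [← Set.image_univ, mean_image_eq μ hadd hinv (fun g => φ (g, b))
      (fun g g' hg => (Prod.ext_iff.1 (hφ hg)).1) K Set.univ, huniv]
    intro g _
    exact Finset.inv_smul_mem_iff.2 (hφK (g, b))
  have hdis : Disjoint (Set.range fun g => φ (g, true)) (Set.range fun g => φ (g, false)) := by
    rw [Set.disjoint_left]
    rintro _ ⟨g, rfl⟩ ⟨g', hg'⟩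
    simpa using hφ hg'
  have := (h01 ((Set.range fun g => φ (g, true)) ∪ Set.range fun g => φ (g, false))).2
  rw [hadd _ _ hdis, hb, hb] at this
  norm_num at this

theorem rightDefect_eq {G : Type*} [Group G] [DecidableEq G] (s : G) (F : Finset G) :
    rightDefect s F = (((F.image fun x => x * s) \ F).card : ℝ) / F.card := by
  rw [rightDefect, ← Finset.coe_image, ← Finset.coe_sdiff, Set.ncard_coe_finset]

theorem rightDefect_nonneg {G : Type*} [Semigroup G] (s : G) (F : Finset G) :
    0 ≤ rightDefect s F := by
  unfold rightDefect; positivity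

/-- **Følner's theorem**: a right amenable group has almost invariant finite sets. -/
theorem IsRightAmenable.exists_rightDefect_lt {G : Type*} [Group G] (h : IsRightAmenable G)
    (K : Finset G) {ε : ℝ} (hε : 0 < ε) :
    ∃ F : Finset G, F.Nonempty ∧ ∀ s ∈ K, rightDefect s F < ε := by
  classical
  by_contra! hK
  set L : Finset G := insert 1 K with hL
  -- Without almost invariant sets, each multiplication by `L` enlarges by `1 + ε`, so some power `L
  -- ^ n` doubles every finite set.
  have hstep : ∀ F : Finset G, (1 + ε) * F.card ≤ ((F * L).card : ℝ) := by
    intro F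
    rcases F.eq_empty_or_nonempty with rfl | hF
    · simp
    obtain ⟨s, hs, hd⟩ := hK F hF
    have hF0 : (0 : ℝ) < F.card := by exact_mod_cast hF.card_pos
    rw [rightDefect_eq, le_div_iff₀ hF0] at hd
    have hsub : F ∪ ((F.image fun x => x * s) \ F) ⊆ F * L := by
      intro x hx
      rcases Finset.mem_union.1 hx with hx | hx
      · exact Finset.mem_mul.2 ⟨x, hx, 1, by simp [hL], mul_one x⟩
      · obtain ⟨y, hy, rfl⟩ := Finset.mem_image.1 (Finset.mem_sdiff.1 hx).1
        exact Finset.mul_mem_mul hy (Finset.mem_insert_of_mem hs)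
    have hc := Finset.card_le_card hsub
    rw [Finset.card_union_of_disjoint Finset.disjoint_sdiff] at hc
    have hc' : (F.card : ℝ) + ((F.image fun x => x * s) \ F).card ≤ (F * L).card := by
      exact_mod_cast hc
    linarith
  have hpow : ∀ (n : ℕ) (F : Finset G), (1 + ε) ^ n * F.card ≤ ((F * L ^ n).card : ℝ) := by
    intro n F
    induction n with
    | zero => simp
    | succ n ih =>
      rw [pow_succ', pow_succ, ← mul_assoc F, mul_assoc]
      exact (mul_le_mul_of_nonneg_left ih (by positivity)).trans (hstep _)
  obtain ⟨n, hn⟩ := pow_unbounded_of_one_lt 2 (show 1 < 1 + ε by linarith)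
  obtain ⟨F, hF⟩ := h.exists_card_mul_lt (L ^ n)
  have hF' : ((F * L ^ n).card : ℝ) < 2 * F.card := by exact_mod_cast hF
  have := hpow n F
  have := mul_le_mul_of_nonneg_right hn.le (Nat.cast_nonneg (α := ℝ) F.card)
  linarith

theorem IsRightAmenable.rightFolner_neBot {G : Type*} [Group G] (h : IsRightAmenable G) :
    (rightFolner G).NeBot := by
  classical
  choose F hFne hF using fun p : Finset G × ℕ =>
    h.exists_rightDefect_lt p.1 (ε := 1 / ((p.2 : ℝ) + 1)) (by positivity)
  refine ((isRightFolnerNet_iff atTop F).1 ⟨Eventually.of_forall hFne, fun s => ?_⟩).neBot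
  refine tendsto_order.2 ⟨fun a ha => Eventually.of_forall fun p =>
    ha.trans_le (rightDefect_nonneg _ _), fun ε hε => ?_⟩
  obtain ⟨n, hn⟩ := exists_nat_one_div_lt hε
  filter_upwards [eventually_ge_atTop (({s}, n) : Finset G × ℕ)] with p hp
  refine (hF p s (hp.1 (Finset.mem_singleton_self s))).trans_le (le_trans ?_ hn.le)
  exact Nat.one_div_le_one_div hp.2

theorem eventually_nonempty_rightFolner (S : Type*) [Semigroup S] :
    ∀ᶠ F in rightFolner S, F.Nonempty :=
  ((isRightFolnerNet_iff (rightFolner S) id).2 tendsto_id).1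

theorem tendsto_rightDefect {S : Type*} [Semigroup S] (s : S) :
    Tendsto (rightDefect s) (rightFolner S) (𝓝 0) :=
  ((isRightFolnerNet_iff (rightFolner S) id).2 tendsto_id).2 s

/-! ### The entropy as an infimum over all finite sets -/

section Trajectory

variable {G A : Type*} [Group G] [AddCommGroup A]

theorem trajectory_coe [DecidableEq A] (α : G →* AddMonoid.End A) (F : Finset G) (X : Finset A) :
    trajectory α F (X : Set A) = ((∑ s ∈ F, X.image (α s) : Finset A) : Set A) := by
  simp [trajectory, Finset.coe_sum]

theorem ncard_trajectory [DecidableEq A] (α : G →* AddMonoid.End A) (F : Finset G)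
    (X : Finset A) :
    (trajectory α F (X : Set A)).ncard = (∑ s ∈ F, X.image (α s)).card := by
  rw [trajectory_coe, Set.ncard_coe_finset]

theorem sum_image_nonempty [DecidableEq A] (α : G →* AddMonoid.End A) (F : Finset G)
    {X : Finset A} (hX : X.Nonempty) : (∑ s ∈ F, X.image (α s)).Nonempty := by
  classical
  induction F using Finset.induction_on with
  | empty => simp
  | insert a F ha ih =>
    rw [Finset.sum_insert ha]
    exact (hX.image _).add ih

theorem sum_image_mul_left [DecidableEq A] [DecidableEq G] (α : G →* AddMonoid.End A) (g : G)
    (F : Finset G) (X : Finset A) :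
    ∑ s ∈ F, X.image (α (g * s)) = (∑ s ∈ F, X.image (α s)).image (α g) := by
  have h := map_sum (Finset.imageAddMonoidHom (α g)) (fun s => X.image (α s)) F
  refine Eq.trans (Finset.sum_congr rfl fun s _ => ?_) h.symm
  rw [map_mul]
  exact (Finset.image_image (s := X) (f := α s) (g := α g)).symm

theorem action_injective (α : G →* AddMonoid.End A) (g : G) : Function.Injective (α g) := by
  refine Function.LeftInverse.injective (g := α g⁻¹) fun a => ?_
  change (α g⁻¹ * α g) a = a
  rw [← map_mul, inv_mul_cancel, map_one]
  rfl

theorem card_sum_image_smul [DecidableEq A] [DecidableEq G] (α : G →* AddMonoid.End A) (g : G)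
    (F : Finset G) (X : Finset A) :
    (∑ s ∈ g • F, X.image (α s)).card = (∑ s ∈ F, X.image (α s)).card := by
  rw [← Finset.image_smul, Finset.sum_image fun _ _ _ _ h => smul_left_cancel g h]
  simp only [smul_eq_mul]
  rw [sum_image_mul_left, Finset.card_image_of_injective _ (action_injective α g)]

theorem card_sum_image_mono [DecidableEq A] (α : G →* AddMonoid.End A) {F F' : Finset G}
    (h : F ⊆ F') {X : Finset A} (hX : X.Nonempty) :
    (∑ s ∈ F, X.image (α s)).card ≤ (∑ s ∈ F', X.image (α s)).card := by
  classical
  rw [← Finset.sum_sdiff h]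
  exact Finset.card_le_card_add_left (sum_image_nonempty α _ hX)

/-- Shearer for the pieces `F ∩ g E`, `g ∈ F E⁻¹`: a point `i` of `F` lies in `g E` exactly for the
`|E|` elements `g = i e⁻¹`, and left translates of `E` have trajectories of equal size. -/
theorem card_trajectory_pow_le [DecidableEq A] [DecidableEq G] (α : G →* AddMonoid.End A)
    {X : Finset A} (hX : X.Nonempty) (F E : Finset G) (hE : E.Nonempty) :
    (∑ s ∈ F, X.image (α s)).card ^ E.card ≤
      (∑ s ∈ E, X.image (α s)).card ^ (F * E⁻¹).card := by
  refine (card_sum_pow_le_prod (fun s => X.image (α s)) (fun _ => hX.image _) F (F * E⁻¹)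
    (fun g => F ∩ g • E) (fun _ _ => Finset.inter_subset_left) E.card hE.card_pos.ne' ?_).trans ?_
  · intro i hi
    rw [← Finset.card_image_of_injective E (f := fun e => i * e⁻¹)
      (fun a b h => inv_injective (mul_left_cancel h))]
    congr 1
    ext g
    simp only [Finset.mem_filter, Finset.mem_inter, Finset.mem_image]
    constructor
    · rintro ⟨-, -, h⟩
      obtain ⟨e, he, rfl⟩ := Finset.mem_smul_finset.1 h
      exact ⟨e, he, by simp⟩
    · rintro ⟨e, he, rfl⟩
      exact ⟨Finset.mul_mem_mul hi (Finset.inv_mem_inv he), hi,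
        Finset.mem_smul_finset.2 ⟨e, he, by simp⟩⟩
  · refine Finset.prod_le_pow_card _ _ _ fun g _ => ?_
    rw [← card_sum_image_smul α g E X]
    exact card_sum_image_mono α Finset.inter_subset_right hX

theorem card_mul_inv_le [DecidableEq G] (F E : Finset G) (hF : F.Nonempty) :
    ((F * E⁻¹).card : ℝ) ≤ F.card * (1 + ∑ e ∈ E, rightDefect e⁻¹ F) := by
  have hF0 : (F.card : ℝ) ≠ 0 := by exact_mod_cast hF.card_pos.ne'
  have hsub : F * E⁻¹ ⊆ F ∪ E.biUnion fun e => (F.image fun x => x * e⁻¹) \ F := by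
    intro x hx
    obtain ⟨y, hy, z, hz, rfl⟩ := Finset.mem_mul.1 hx
    by_cases h : y * z ∈ F
    · exact Finset.mem_union_left _ h
    · refine Finset.mem_union_right _ (Finset.mem_biUnion.2 ⟨z⁻¹, Finset.mem_inv'.1 hz, ?_⟩)
      exact Finset.mem_sdiff.2 ⟨Finset.mem_image.2 ⟨y, hy, by simp⟩, h⟩
  have hc := (Finset.card_le_card hsub).trans
    ((Finset.card_union_le _ _).trans (Nat.add_le_add_left Finset.card_biUnion_le _))
  rw [mul_add, mul_one, Finset.mul_sum]
  simp only [rightDefect_eq, mul_div_cancel₀ _ hF0]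
  exact_mod_cast hc

/-- The quotient `log |T_F(α, X)| / |F|`. -/
noncomputable def trajectoryRatio (α : G →* AddMonoid.End A) (X : Set A) (F : Finset G) : ℝ :=
  Real.log ((trajectory α F X).ncard : ℝ) / (F.card : ℝ)

theorem trajectoryRatio_nonneg (α : G →* AddMonoid.End A) (X : Set A) (F : Finset G) :
    0 ≤ trajectoryRatio α X F :=
  div_nonneg (Real.log_natCast_nonneg _) (Nat.cast_nonneg _)

theorem trajectoryRatio_le (α : G →* AddMonoid.End A) {X : Set A} (hX : X.Nonempty)
    (hfin : X.Finite) {F E : Finset G} (hF : F.Nonempty) (hE : E.Nonempty) :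
    trajectoryRatio α X F ≤ trajectoryRatio α X E * (1 + ∑ e ∈ E, rightDefect e⁻¹ F) := by
  classical
  lift X to Finset A using hfin
  have hF0 : (0 : ℝ) < F.card := by exact_mod_cast hF.card_pos
  have hE0 : (0 : ℝ) < E.card := by exact_mod_cast hE.card_pos
  have hX' : X.Nonempty := hX
  unfold trajectoryRatio
  rw [ncard_trajectory, ncard_trajectory]
  have hpos : (0 : ℝ) < (∑ s ∈ F, X.image (α s)).card := by
    exact_mod_cast (sum_image_nonempty α F hX').card_pos
  have h := Real.log_le_log (pow_pos hpos E.card)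
    (by exact_mod_cast card_trajectory_pow_le α hX' F E hE :
      ((∑ s ∈ F, X.image (α s)).card : ℝ) ^ E.card ≤
        ((∑ s ∈ E, X.image (α s)).card : ℝ) ^ (F * E⁻¹).card)
  rw [Real.log_pow, Real.log_pow] at h
  have h2 := mul_le_mul_of_nonneg_right (card_mul_inv_le F E hF)
    (Real.log_natCast_nonneg (∑ s ∈ E, X.image (α s)).card)
  rw [div_mul_eq_mul_div, div_le_div_iff₀ hF0 hE0]
  linarith

/-- The infimum is a lower bound at every non-empty `F`. For fixed `E`, the factor in
`trajectoryRatio_le` tends to `1` along the Følner filter, so no fixed ratio is exceeded in the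
limit. -/
theorem tendsto_trajectoryRatio (α : G →* AddMonoid.End A) {X : Set A} (hX : X.Nonempty)
    (hfin : X.Finite) :
    Tendsto (trajectoryRatio α X) (rightFolner G)
      (𝓝 (sInf (trajectoryRatio α X '' {E | E.Nonempty}))) := by
  have hbdd : BddBelow (trajectoryRatio α X '' {E | E.Nonempty}) :=
    ⟨0, by rintro _ ⟨E, -, rfl⟩; exact trajectoryRatio_nonneg α X E⟩
  refine tendsto_order.2 ⟨fun a ha => ?_, fun a ha => ?_⟩
  · filter_upwards [eventually_nonempty_rightFolner G] with F hF
    exact ha.trans_le (csInf_le hbdd ⟨F, hF, rfl⟩)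
  · obtain ⟨_, ⟨E, hE, rfl⟩, hlt⟩ := exists_lt_of_csInf_lt
      (Set.Nonempty.image _ ⟨{1}, Finset.singleton_nonempty 1⟩) ha
    have hlim : Tendsto (fun F => trajectoryRatio α X E * (1 + ∑ e ∈ E, rightDefect e⁻¹ F))
        (rightFolner G) (𝓝 (trajectoryRatio α X E)) := by
      have := ((tendsto_finsetSum E fun e _ => tendsto_rightDefect (e⁻¹ : G)).const_add
        1).const_mul (trajectoryRatio α X E)
      simpa using this
    filter_upwards [eventually_nonempty_rightFolner G, hlim.eventually (gt_mem_nhds hlt)]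
      with F hF h
    exact (trajectoryRatio_le α hX hfin hF hE).trans_lt h

theorem algEntropyOn_eq_sInf (hG : IsRightAmenable G) (α : G →* AddMonoid.End A) {X : Set A}
    (hX : X.Nonempty) (hfin : X.Finite) :
    algEntropyOn α X = sInf (trajectoryRatio α X '' {E | E.Nonempty}) :=
  haveI := hG.rightFolner_neBot
  (tendsto_trajectoryRatio α hX hfin).limUnder_eq

theorem algEntropyOn_nonneg (hG : IsRightAmenable G) (α : G →* AddMonoid.End A) {X : Set A}
    (hX : X.Nonempty) (hfin : X.Finite) : 0 ≤ algEntropyOn α X := by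
  rw [algEntropyOn_eq_sInf hG α hX hfin]
  refine Real.sInf_nonneg ?_
  rintro _ ⟨E, -, rfl⟩
  exact trajectoryRatio_nonneg α X E

theorem algEntropyOn_le (hG : IsRightAmenable G) (α : G →* AddMonoid.End A) {X : Set A}
    (hX : X.Nonempty) (hfin : X.Finite) {E : Finset G} (hE : E.Nonempty) :
    algEntropyOn α X ≤ trajectoryRatio α X E := by
  rw [algEntropyOn_eq_sInf hG α hX hfin]
  exact csInf_le ⟨0, by rintro _ ⟨E, -, rfl⟩; exact trajectoryRatio_nonneg α X E⟩ ⟨E, hE, rfl⟩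

theorem exists_trajectoryRatio_lt (hG : IsRightAmenable G) (α : G →* AddMonoid.End A) {X : Set A}
    (hX : X.Nonempty) (hfin : X.Finite) {c : ℝ} (hc : algEntropyOn α X < c) :
    ∃ E : Finset G, E.Nonempty ∧ trajectoryRatio α X E < c := by
  rw [algEntropyOn_eq_sInf hG α hX hfin] at hc
  obtain ⟨_, ⟨E, hE, rfl⟩, hlt⟩ := exists_lt_of_csInf_lt
    (Set.Nonempty.image _ ⟨{1}, Finset.singleton_nonempty 1⟩) hc
  exact ⟨E, hE, hlt⟩

/-! ### Passing from the subgroup to the group -/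

theorem trajectory_nonempty (α : G →* AddMonoid.End A) (F : Finset G) {X : Set A}
    (hX : X.Nonempty) (hfin : X.Finite) : (trajectory α F X).Nonempty := by
  classical
  lift X to Finset A using hfin
  rw [trajectory_coe]
  exact sum_image_nonempty α F hX

theorem trajectory_finite (α : G →* AddMonoid.End A) (F : Finset G) {X : Set A}
    (hfin : X.Finite) : (trajectory α F X).Finite := by
  classical
  lift X to Finset A using hfin
  rw [trajectory_coe]
  exact Finset.finite_toSet _

/-- Each `α m` is additive, so it commutes with the sum over `R`; injectivity ensures that no
product `m r` is counted twice. -/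
theorem trajectory_mul_subgroup [DecidableEq G] (α : G →* AddMonoid.End A) (N : Subgroup G)
    (M : Finset N) (R : Finset G) {X : Set A} (hfin : X.Finite)
    (hinj : Set.InjOn (fun p : N × G => (p.1 : G) * p.2) (M ×ˢ R : Finset (N × G))) :
    trajectory α ((M ×ˢ R).image fun p : N × G => (p.1 : G) * p.2) X =
      trajectory (α.comp N.subtype) M (trajectory α R X) := by
  classical
  lift X to Finset A using hfin
  rw [trajectory_coe, trajectory_coe, trajectory_coe, Finset.sum_image hinj, Finset.sum_product]
  congr 1
  exact Finset.sum_congr rfl fun m _ => sum_image_mul_left α m R X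

/-- If the entropies of the restriction to `N` of all the trajectories of `X` have a common bound,
then the entropy on `X` vanishes. -/
theorem algEntropyOn_eq_zero (hG : IsRightAmenable G) (α : G →* AddMonoid.End A)
    (N : Subgroup G) [N.Normal] [Infinite (G ⧸ N)] {X : Set A} (hX : X.Nonempty)
    (hfin : X.Finite) (C : ℝ)
    (hC : ∀ R : Finset G, algEntropyOn (α.comp N.subtype) (trajectory α R X) ≤ C) :
    algEntropyOn α X = 0 := by
  classical
  refine le_antisymm (le_of_forall_pos_le_add fun ε hε => ?_) (algEntropyOn_nonneg hG α hX hfin)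
  -- Chosen so that `(C + 1) / (n + 1) ≤ ε`.
  obtain ⟨n, hn⟩ := exists_nat_gt ((C + 1) / ε)
  obtain ⟨Q, hQ⟩ := Infinite.exists_subset_card_eq (G ⧸ N) (n + 1)
  set R : Finset G := Q.image Quotient.out with hR
  have hRcard : R.card = n + 1 := by
    rw [hR, Finset.card_image_of_injective _ Quotient.out_injective, hQ]
  -- `M` depends on `R`, but the bound `C + 1` on its ratio does not.
  obtain ⟨M, hM, hlt⟩ := exists_trajectoryRatio_lt (hG.subgroup N) (α.comp N.subtype)
    (trajectory_nonempty α R hX hfin) (trajectory_finite α R hfin)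
    ((hC R).trans_lt (lt_add_one C))
  have hRinj : ∀ r ∈ R, ∀ r' ∈ R, (r : G ⧸ N) = r' → r = r' := by
    intro r hr r' hr' h
    obtain ⟨q, -, rfl⟩ := Finset.mem_image.1 hr
    obtain ⟨q', -, rfl⟩ := Finset.mem_image.1 hr'
    rw [QuotientGroup.out_eq', QuotientGroup.out_eq'] at h
    rw [h]
  have hinj : Set.InjOn (fun p : N × G => (p.1 : G) * p.2) (M ×ˢ R : Finset (N × G)) := by
    rintro ⟨m, r⟩ hp ⟨m', r'⟩ hp' h
    have hr := (Finset.mem_product.1 (Finset.mem_coe.1 hp)).2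
    have hr' := (Finset.mem_product.1 (Finset.mem_coe.1 hp')).2
    simp only at h hr hr'
    have hq := congrArg (QuotientGroup.mk' N) h
    simp only [map_mul, QuotientGroup.mk'_apply, (QuotientGroup.eq_one_iff _).2 m.2,
      (QuotientGroup.eq_one_iff _).2 m'.2, one_mul] at hq
    obtain rfl := hRinj r hr r' hr' hq
    rw [Subtype.ext (mul_right_cancel h)]
  have hRne : R.Nonempty := Finset.card_pos.1 (by omega)
  refine (algEntropyOn_le hG α hX hfin ((hM.product hRne).image
    fun p : N × G => (p.1 : G) * p.2)).trans ?_
  rw [trajectoryRatio, trajectory_mul_subgroup α N M R hfin hinj, Finset.card_image_of_injOn hinj,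
    Finset.card_product, hRcard, Nat.cast_mul, ← div_div]
  change trajectoryRatio (α.comp N.subtype) (trajectory α R X) M / _ ≤ _
  rw [zero_add, div_le_iff₀ (by positivity)]
  rw [div_lt_iff₀ hε] at hn
  push_cast
  nlinarith

theorem exists_trajectory_eq_addSubgroup (α : G →* AddMonoid.End A) (F : Finset G)
    (B : AddSubgroup A) : ∃ B' : AddSubgroup A, trajectory α F (B : Set A) = B' := by
  classical
  unfold trajectory
  induction F using Finset.induction_on with
  | empty => exact ⟨⊥, by rw [Finset.sum_empty]; rfl⟩
  | insert a F ha ih =>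
    obtain ⟨B', hB'⟩ := ih
    exact ⟨B.map (α a) ⊔ B', by rw [Finset.sum_insert ha, hB', AddSubgroup.add_normal]; rfl⟩

end Trajectory

theorem exists_real_bound {x : EReal} (h : x < ⊤) : ∃ C : ℝ, x ≤ C := by
  obtain ⟨C, hC, -⟩ := EReal.lt_iff_exists_real_btwn.1 h
  exact ⟨C, hC.le⟩

end AlgebraicEntropy

open AlgebraicEntropy in
theorem mainTheorem6 {G : Type*} [Group G] (hG : AlgebraicEntropy.IsAmenable G)
    {A : Type*} [AddCommGroup A] (α : G →* AddMonoid.End A)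
    (N : Subgroup G) (hNormal : N.Normal) (hN : N ≠ ⊥) (hquot : Infinite (G ⧸ N)) :
    (AlgebraicEntropy.ent (α.comp N.subtype) < ⊤ → AlgebraicEntropy.ent α = 0) ∧
    (AlgebraicEntropy.hAlg (α.comp N.subtype) < ⊤ → AlgebraicEntropy.hAlg α = 0) := by
  constructor
  · intro h
    obtain ⟨C, hC⟩ := exists_real_bound h
    have key : ∀ B : AddSubgroup A, (B : Set A).Finite → algEntropyOn α (B : Set A) = 0 := by
      intro B hB
      refine algEntropyOn_eq_zero hG.2 α N ⟨0, B.zero_mem⟩ hB C fun R => ?_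
      obtain ⟨B', hB'⟩ := exists_trajectory_eq_addSubgroup α R B
      have hfin := trajectory_finite α R hB
      rw [hB'] at hfin ⊢
      exact EReal.coe_le_coe_iff.1 ((le_iSup₂ (f := fun (B : AddSubgroup A) (_ : (B : Set A).Finite)
        => (algEntropyOn (α.comp N.subtype) (B : Set A) : EReal)) B' hfin).trans hC)
    refine le_antisymm (iSup₂_le fun B hB => by rw [key B hB]; rfl) ?_
    -- A supremum of zeros in `EReal` is `0` only if some index exists; the trivial subgroup
    -- provides one.
    have hbot : ((⊥ : AddSubgroup A) : Set A).Finite := by simp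
    refine le_trans (le_of_eq ?_) (le_iSup₂ (f := fun (B : AddSubgroup A)
      (_ : (B : Set A).Finite) => (algEntropyOn α (B : Set A) : EReal)) ⊥ hbot)
    simp only [key ⊥ hbot, EReal.coe_zero]
  · intro h
    obtain ⟨C, hC⟩ := exists_real_bound h
    have key : ∀ X : Set A, X.Nonempty ∧ X.Finite → algEntropyOn α X = 0 := by
      rintro X ⟨hX, hfin⟩
      refine algEntropyOn_eq_zero hG.2 α N hX hfin C fun R => ?_
      exact EReal.coe_le_coe_iff.1 ((le_iSup₂ (f := fun (X : Set A) (_ : X.Nonempty ∧ X.Finite)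
        => (algEntropyOn (α.comp N.subtype) X : EReal)) (trajectory α R X)
          ⟨trajectory_nonempty α R hX hfin, trajectory_finite α R hfin⟩).trans hC)
    refine le_antisymm (iSup₂_le fun X hX => by rw [key X hX]; rfl) ?_
    have h0 : ({0} : Set A).Nonempty ∧ ({0} : Set A).Finite := by simp
    refine le_trans (le_of_eq ?_) (le_iSup₂ (f := fun (X : Set A) (_ : X.Nonempty ∧ X.Finite)
        => (algEntropyOn α X : EReal)) {0} h0)
    simp only [key {0} h0, EReal.coe_zero]
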